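/- Let $A\in\mathbb R^{n\times m}$ be the payoff matrix of a two-player zero-sum game in which the row player chooses $f\in\Delta_n$ to maximize $f^\top A y$ and the column player chooses $y\in\Delta_m$ to minimize it, where $\Delta_k$ denotes the probability simplex in $\mathbb R^k$. Suppose the game has a unique Nash equilibrium $(f^*,y^*)$, that is, a unique pair in $\Delta_n\times\Delta_m$ with $$f^\top A y^*\le {f^*}^\top A y^*\le {f^*}^\top A y\qquad\text{for all } f\in\Delta_n,\ y\in\Delta_m .$$ For a learning rate $\eta>0$ and an exploiting rate $\alpha>0$, let both players run Accurate Multiplicative Weights Update (AMWU): $f_1=f_2=(1/n,\dots,1/n)$, $y_1=y_2=(1/m,\dots,1/m)$, and for $t\ge 2$ $$f_{t+1}(i)=\frac{f_t(i)\,e^{\eta((\alpha+1)(Ay_t)_i-\alpha(Ay_{t-1})_i)}}{\sum_{k} f_t(k)\,e^{\eta((\alpha+1)(Ay_t)_k-\alpha(Ay_{t-1})_k)}},\qquad y_{t+1}(j)=\frac{y_t(j)\,e^{-\eta((\alpha+1)(A^\top f_t)_j-\alpha(A^\top f_{t-1})_j)}}{\sum_{k} y_t(k)\,e^{-\eta((\alpha+1)(A^\top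 f_t)_k-\alpha(A^\top f_{t-1})_k)}} .$$ Then for every $b\in(0,1]$ there is $\eta_0>0$ (depending on $A$ and $b$) such that for every $\eta\in(0,\eta_0)$, the AMWU iterates with $\alpha=\eta^{b-1}$ converge in the last round to the equilibrium: $$\lim_{t\to\infty}(f_t,y_t)=(f^*,y^*).$$ -/

import Mathlib

open Filter Topology
open scoped Matrix

/-- A Nash equilibrium `(f, y)` of the zero-sum matrix game `A`: mixed strategies
`f ∈ Δ_n` (row player, maximizing `fᵀ A y`) and `y ∈ Δ_m` (column player, minimizing `fᵀ A y`)
such that neither player gains by deviating unilaterally. -/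
def IsNashEquilibrium {n m : ℕ} (A : Matrix (Fin n) (Fin m) ℝ)
    (f : Fin n → ℝ) (y : Fin m → ℝ) : Prop :=
  f ∈ stdSimplex ℝ (Fin n) ∧ y ∈ stdSimplex ℝ (Fin m) ∧
    (∀ f' ∈ stdSimplex ℝ (Fin n), f' ⬝ᵥ A *ᵥ y ≤ f ⬝ᵥ A *ᵥ y) ∧
    (∀ y' ∈ stdSimplex ℝ (Fin m), f ⬝ᵥ A *ᵥ y ≤ f ⬝ᵥ A *ᵥ y')

/-- `(f, y)` is the unique Nash equilibrium of the zero-sum matrix game `A`. -/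
def IsUniqueNashEquilibrium {n m : ℕ} (A : Matrix (Fin n) (Fin m) ℝ)
    (f : Fin n → ℝ) (y : Fin m → ℝ) : Prop :=
  IsNashEquilibrium A f y ∧ ∀ f' y', IsNashEquilibrium A f' y' → f' = f ∧ y' = y

/-- Multiplicative reweighting: `p` is replaced by the vector with entries
`p i * exp (g i) / ∑ j, p j * exp (g j)`. -/
noncomputable def multWeights {k : ℕ} (p g : Fin k → ℝ) : Fin k → ℝ :=
  fun i => p i * Real.exp (g i) / ∑ j, p j * Real.exp (g j)

/-- One round of Accurate Multiplicative Weights Update with learning rate `η` and exploiting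
rate `α`, played by both players: from the current pair `(f_t, y_t)` and the previous pair
`(f_{t-1}, y_{t-1})` to `(f_{t+1}, y_{t+1})`. The column player, who minimizes, uses the payoff
matrix `-Aᵀ`. -/
noncomputable def amwuStep {n m : ℕ} (A : Matrix (Fin n) (Fin m) ℝ) (η α : ℝ)
    (cur prev : (Fin n → ℝ) × (Fin m → ℝ)) : (Fin n → ℝ) × (Fin m → ℝ) :=
  (multWeights cur.1
      (fun i => η * ((α + 1) * (A *ᵥ cur.2) i - α * (A *ᵥ prev.2) i)),
    multWeights cur.2
      (fun j => -(η * ((α + 1) * (Aᵀ *ᵥ cur.1) j - α * (Aᵀ *ᵥ prev.1) j))))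

/-- The iterates of Accurate Multiplicative Weights Update in self-play. The first two pairs of
strategies are uniform. Rounds are numbered from `0`, so `amwu A η α t` is the pair
`(f_{t+1}, y_{t+1})` when rounds are numbered from `1`. -/
noncomputable def amwu {n m : ℕ} (A : Matrix (Fin n) (Fin m) ℝ) (η α : ℝ) :
    ℕ → (Fin n → ℝ) × (Fin m → ℝ)
  | 0 => (fun _ => 1 / (n : ℝ), fun _ => 1 / (m : ℝ))
  | 1 => (fun _ => 1 / (n : ℝ), fun _ => 1 / (m : ℝ))
  | t + 2 => amwuStep A η α (amwu A η α (t + 1)) (amwu A η α t)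

/-!
Write `γ = η α = η ^ b`, so that `η ≤ γ` and `γ → 0` as `η → 0`. The iterates become a two-sequence
scheme with step `η` and prediction length `γ`: the auxiliary strategy
`multWeights f_t (-γ A y_{t-1})` is reweighted by `η A y_t` in each round, and `f_{t+1}` is obtained
from the result by reweighting with `γ A y_t`; likewise for the column player with the payoff
matrix `-Aᵀ`.

The proof follows the cross entropy of the auxiliary strategies relative to the equilibrium. The
terms linear in `η` cancel up to the equilibrium gap, which is nonnegative. The remainder is an
increment of cumulant generating functions, and their convexity, with a second-order expansion of
the slope, gives a decrease of order `η γ` times the variance of each player's payoff vector under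
the own strategy (`logMGF_sub_le`). This uses only `η ≤ γ` and that `γ` times the entries of
`A` is small; in particular `γ ^ 2` need not be small compared with `η`, so every `b` in `(0, 1]`
is covered. The error of predicting `A y_t` by `A y_{t-1}` is controlled by the movement of the
strategies, which is in turn controlled by the variances, so a multiple of the squared movement is
added to the energy (`amwuEnergy_succ_le`).

Hence the payoff variances tend to zero, while the bounded cross entropies keep the iterates away
from zero on the equilibrium supports. At a limit point `(f, y)` the vector `A y` is therefore
constant on the support of `f*`, and `Aᵀ f` on that of `y*`, and both constants are the value of the
game. Uniqueness of the equilibrium implies strict complementarity, by Farkas' lemma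
(`IsUniqueNashEquilibrium.mulVec_lt`); so a small admixture of `y` to `y*` remains optimal, and
uniqueness gives `y = y*` (`IsUniqueNashEquilibrium.eq_of_equalizes`). By compactness the iterates
converge.
-/

/-! ### Linear inequalities -/

/-- **Farkas' lemma** for linear functionals on a real vector space. The induction removes one
functional `a k`: either it is not needed, or a point `x` violating the implication without it
satisfies `0 < a k x`, and projecting along `x` onto the kernel of `a k` reduces to the others. -/
theorem exists_nonneg_sum_smul_eq_of_nonpos {V ι : Type*} [AddCommGroup V] [Module ℝ V]
    (s : Finset ι) (a : ι → V →ₗ[ℝ] ℝ) (c : V →ₗ[ℝ] ℝ)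
    (h : ∀ x, (∀ i ∈ s, a i x ≤ 0) → c x ≤ 0) :
    ∃ l : ι → ℝ, (∀ i, 0 ≤ l i) ∧ ∀ x, c x = ∑ i ∈ s, l i * a i x := by
  classical
  induction s using Finset.induction_on generalizing a c with
  | empty =>
    refine ⟨0, fun i => le_rfl, fun x => ?_⟩
    have h1 := h x (by simp)
    have h2 := h (-x) (by simp)
    simp only [map_neg] at h2
    simp only [Finset.sum_empty]
    linarith
  | insert k s hk ih =>
    by_cases hs : ∀ x, (∀ i ∈ s, a i x ≤ 0) → c x ≤ 0
    · obtain ⟨l, hl, hc⟩ := ih a c hs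
      refine ⟨fun i => if i = k then 0 else l i, fun i => ?_, fun x => ?_⟩
      · dsimp only
        split_ifs
        exacts [le_rfl, hl i]
      · rw [Finset.sum_insert hk, hc x]
        simp only [if_true, zero_mul, zero_add]
        refine Finset.sum_congr rfl fun i hi => ?_
        rw [if_neg (ne_of_mem_of_not_mem hi hk)]
    · push Not at hs
      obtain ⟨x, hx, hcx⟩ := hs
      have hkx : 0 < a k x := by
        by_contra hneg
        refine hcx.not_ge (h x fun i hi => ?_)
        rcases Finset.mem_insert.1 hi with rfl | hi
        exacts [not_lt.1 hneg, hx i hi]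
      obtain ⟨l, hl, hc⟩ := ih (fun i => a i - (a i x / a k x) • a k)
        (c - (c x / a k x) • a k) (fun z hz => by
          have := h (z - (a k z / a k x) • x) (fun i hi => by
            rcases Finset.mem_insert.1 hi with rfl | hi
            · simp only [map_sub, map_smul, smul_eq_mul]
              rw [div_mul_cancel₀ _ hkx.ne', sub_self]
            · have := hz i hi
              simp only [LinearMap.sub_apply, LinearMap.smul_apply, smul_eq_mul, map_sub,
                map_smul] at this ⊢
              calc _ = _ := by ring
                _ ≤ 0 := this)
          simp only [LinearMap.sub_apply, LinearMap.smul_apply, smul_eq_mul, map_sub,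
            map_smul] at this ⊢
          calc _ = _ := by ring
            _ ≤ 0 := this)
      have hnn : 0 ≤ c x / a k x - ∑ i ∈ s, l i * (a i x / a k x) := by
        have : ∑ i ∈ s, l i * (a i x / a k x) ≤ 0 := Finset.sum_nonpos fun i hi =>
          mul_nonpos_of_nonneg_of_nonpos (hl i)
            (div_nonpos_of_nonpos_of_nonneg (hx i hi) hkx.le)
        have := div_pos hcx hkx
        linarith
      refine ⟨fun i => if i = k then c x / a k x - ∑ i ∈ s, l i * (a i x / a k x) else l i,
        fun i => ?_, fun z => ?_⟩
      · dsimp only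
        split_ifs
        exacts [hnn, hl i]
      · have hz := hc z
        simp only [LinearMap.sub_apply, LinearMap.smul_apply, smul_eq_mul] at hz
        have hs : ∀ i ∈ s, (if i = k then c x / a k x - ∑ i ∈ s, l i * (a i x / a k x) else l i)
            * a i z = l i * a i z := fun i hi => by rw [if_neg (ne_of_mem_of_not_mem hi hk)]
        rw [Finset.sum_insert hk, Finset.sum_congr rfl hs]
        dsimp only
        rw [if_pos rfl, sub_mul, Finset.sum_mul]
        have : ∑ i ∈ s, l i * (a i z - a i x / a k x * a k z)
            = ∑ i ∈ s, l i * a i z - ∑ i ∈ s, l i * (a i x / a k x) * a k z := by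
          rw [← Finset.sum_sub_distrib]
          exact Finset.sum_congr rfl fun i _ => by ring
        linarith

/-! ### Equilibria of zero-sum games -/

section Simplex

variable {ι : Type*} [Fintype ι] {p g h : ι → ℝ} {c : ℝ}

theorem dotProduct_le_of_mem_stdSimplex (hp : p ∈ stdSimplex ℝ ι) (hg : ∀ i, g i ≤ c) :
    p ⬝ᵥ g ≤ c := by
  calc p ⬝ᵥ g ≤ ∑ i, p i * c := Finset.sum_le_sum fun i _ =>
        mul_le_mul_of_nonneg_left (hg i) (hp.1 i)
    _ = c := by rw [← Finset.sum_mul, hp.2, one_mul]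

theorem le_dotProduct_of_mem_stdSimplex (hp : p ∈ stdSimplex ℝ ι) (hg : ∀ i, c ≤ g i) :
    c ≤ p ⬝ᵥ g := by
  have := dotProduct_le_of_mem_stdSimplex (g := -g) (c := -c) hp (fun i => by simpa using hg i)
  rw [dotProduct_neg] at this
  linarith

/-- A pointwise bound that is attained on average is attained on the support. -/
theorem eq_of_dotProduct_eq_of_le (hp : p ∈ stdSimplex ℝ ι) (hg : ∀ i, g i ≤ c)
    (h : p ⬝ᵥ g = c) {i : ι} (hi : p i ≠ 0) : g i = c := by
  have hsum : ∑ j, p j * (c - g j) = 0 := by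
    simp only [mul_sub, Finset.sum_sub_distrib, ← Finset.sum_mul, hp.2, one_mul]
    rw [dotProduct] at h
    linarith
  have := (Finset.sum_eq_zero_iff_of_nonneg fun j _ =>
    mul_nonneg (hp.1 j) (sub_nonneg.2 (hg j))).1 hsum i (Finset.mem_univ i)
  rcases mul_eq_zero.1 this with h | h
  exacts [absurd h hi, by linarith]

theorem dotProduct_eq_of_eq_on_support (hp : p ∈ stdSimplex ℝ ι)
    (hg : ∀ i, p i ≠ 0 → g i = c) : p ⬝ᵥ g = c := by
  calc p ⬝ᵥ g = ∑ i, p i * c := Finset.sum_congr rfl fun i _ => by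
        by_cases h : p i = 0
        · simp [h]
        · rw [hg i h]
    _ = c := by rw [← Finset.sum_mul, hp.2, one_mul]

end Simplex

section Game

variable {n m : ℕ} {A : Matrix (Fin n) (Fin m) ℝ} {f : Fin n → ℝ} {y : Fin m → ℝ}

theorem dotProduct_mulVec_eq_transpose (A : Matrix (Fin n) (Fin m) ℝ) (f : Fin n → ℝ)
    (y : Fin m → ℝ) : f ⬝ᵥ A *ᵥ y = y ⬝ᵥ Aᵀ *ᵥ f := by
  rw [Matrix.dotProduct_mulVec, dotProduct_comm, Matrix.mulVec_transpose]

theorem isNashEquilibrium_of_bounds (hf : f ∈ stdSimplex ℝ (Fin n))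
    (hy : y ∈ stdSimplex ℝ (Fin m)) {v : ℝ} (h1 : ∀ i, (A *ᵥ y) i ≤ v)
    (h2 : ∀ j, v ≤ (Aᵀ *ᵥ f) j) : IsNashEquilibrium A f y := by
  refine ⟨hf, hy, fun f' hf' => ?_, fun y' hy' => ?_⟩
  · refine (dotProduct_le_of_mem_stdSimplex hf' h1).trans ?_
    rw [dotProduct_mulVec_eq_transpose]
    exact le_dotProduct_of_mem_stdSimplex hy h2
  · refine (dotProduct_le_of_mem_stdSimplex hf h1).trans ?_
    rw [dotProduct_mulVec_eq_transpose]
    exact le_dotProduct_of_mem_stdSimplex hy' h2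

theorem IsNashEquilibrium.mulVec_le (h : IsNashEquilibrium A f y) (i : Fin n) :
    (A *ᵥ y) i ≤ f ⬝ᵥ A *ᵥ y := by
  have := h.2.2.1 _ (single_mem_stdSimplex ℝ i)
  rwa [single_one_dotProduct] at this

theorem IsNashEquilibrium.le_transpose_mulVec (h : IsNashEquilibrium A f y) (j : Fin m) :
    f ⬝ᵥ A *ᵥ y ≤ (Aᵀ *ᵥ f) j := by
  have := h.2.2.2 _ (single_mem_stdSimplex ℝ j)
  rwa [dotProduct_mulVec_eq_transpose A f (Pi.single j 1), single_one_dotProduct] at this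

theorem dotProduct_neg_transpose_mulVec (A : Matrix (Fin n) (Fin m) ℝ) (f : Fin n → ℝ)
    (y : Fin m → ℝ) : y ⬝ᵥ (-Aᵀ) *ᵥ f = -(f ⬝ᵥ A *ᵥ y) := by
  rw [Matrix.neg_mulVec, dotProduct_neg, dotProduct_mulVec_eq_transpose A]

theorem IsNashEquilibrium.swap (h : IsNashEquilibrium A f y) :
    IsNashEquilibrium (-Aᵀ) y f := by
  refine ⟨h.2.1, h.1, fun y' hy' => ?_, fun f' hf' => ?_⟩
  · rw [dotProduct_neg_transpose_mulVec, dotProduct_neg_transpose_mulVec]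
    exact neg_le_neg (h.2.2.2 y' hy')
  · rw [dotProduct_neg_transpose_mulVec, dotProduct_neg_transpose_mulVec]
    exact neg_le_neg (h.2.2.1 f' hf')

theorem IsUniqueNashEquilibrium.swap (h : IsUniqueNashEquilibrium A f y) :
    IsUniqueNashEquilibrium (-Aᵀ) y f := by
  refine ⟨h.1.swap, fun y' f' h' => ?_⟩
  have := h'.swap
  rw [Matrix.transpose_neg, Matrix.transpose_transpose, neg_neg] at this
  exact (h.2 f' y' this).symm

theorem inv_sum_smul_mem_stdSimplex {ι : Type*} [Fintype ι] {u : ι → ℝ} (hu : ∀ i, 0 ≤ u i)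
    (hs : 0 < ∑ i, u i) : (∑ i, u i)⁻¹ • u ∈ stdSimplex ℝ ι := by
  refine ⟨fun i => mul_nonneg (inv_nonneg.2 hs.le) (hu i), ?_⟩
  simp only [Pi.smul_apply, smul_eq_mul, ← Finset.mul_sum]
  exact inv_mul_cancel₀ hs.ne'

/-- **Strict complementarity** at a unique equilibrium: a pure strategy that is not played is not
a best response. By Farkas' lemma, either some optimal strategy of the opponent makes it a strict
loss or some optimal strategy plays it, and optimal strategies are unique. -/
theorem IsUniqueNashEquilibrium.mulVec_lt (h : IsUniqueNashEquilibrium A f y) {i : Fin n}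
    (hi : f i = 0) : (A *ᵥ y) i < f ⬝ᵥ A *ᵥ y := by
  classical
  set v := f ⬝ᵥ A *ᵥ y with hv
  -- `a k u ≤ 0` for all `k` says that `u ≥ 0` and that `u` secures `v` per unit of mass against
  -- every column.
  let a : Fin m ⊕ Fin n → (Fin n → ℝ) →ₗ[ℝ] ℝ := Sum.elim
    (fun j => v • (∑ k, LinearMap.proj k) - (LinearMap.proj j).comp (Matrix.mulVecLin Aᵀ))
    (fun k => -LinearMap.proj k)
  by_cases hc : ∀ u, (∀ k ∈ Finset.univ, a k u ≤ 0) →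
      (LinearMap.proj i : (Fin n → ℝ) →ₗ[ℝ] ℝ) u ≤ 0
  · obtain ⟨l, hl, hlc⟩ := exists_nonneg_sum_smul_eq_of_nonpos Finset.univ a _ hc
    set w : Fin m → ℝ := fun j => l (Sum.inl j) with hw
    have hkey : ∀ k, (Pi.single k 1 : Fin n → ℝ) i
        = v * ∑ j, w j - (A *ᵥ w) k - l (Sum.inr k) := by
      intro k
      have := hlc (Pi.single k 1)
      rw [LinearMap.proj_apply] at this
      rw [this, Fintype.sum_sum_type]
      have e1 : ∀ j, a (Sum.inl j) (Pi.single k 1) = v - A k j := by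
        intro j
        simp [a]
      have e2 : ∀ k', a (Sum.inr k') (Pi.single k 1) = - (Pi.single k 1 : Fin n → ℝ) k' := by
        intro k'
        simp [a]
      simp only [e1, e2]
      have e3 : ∑ k', l (Sum.inr k') * -(Pi.single k 1 : Fin n → ℝ) k' = - l (Sum.inr k) := by
        simp [Pi.single_apply]
      rw [e3, Matrix.mulVec, dotProduct, Finset.mul_sum]
      simp only [mul_sub, Finset.sum_sub_distrib, hw]
      rw [Finset.sum_congr rfl fun j _ => mul_comm (l (Sum.inl j)) v,
        Finset.sum_congr rfl fun j _ => mul_comm (l (Sum.inl j)) (A k j)]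
      ring
    have hle : ∀ k, (A *ᵥ w) k ≤ v * ∑ j, w j := by
      intro k
      have h1 := hkey k
      have h2 := hl (Sum.inr k)
      have h3 : 0 ≤ (Pi.single k 1 : Fin n → ℝ) i := by
        rw [Pi.single_apply]; split_ifs <;> norm_num
      linarith
    have hlt : (A *ᵥ w) i < v * ∑ j, w j := by
      have h1 := hkey i
      have h2 := hl (Sum.inr i)
      rw [Pi.single_eq_same] at h1
      linarith
    have hs : 0 < ∑ j, w j := by
      refine lt_of_le_of_ne (Finset.sum_nonneg fun j _ => hl _) fun h0 => ?_
      have hw0 : w = 0 := by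
        funext j
        exact (Finset.sum_eq_zero_iff_of_nonneg fun j _ => hl _).1 h0.symm j (Finset.mem_univ j)
      simp [hw0] at hlt
    have hN : IsNashEquilibrium A f ((∑ j, w j)⁻¹ • w) := by
      refine isNashEquilibrium_of_bounds h.1.1 (inv_sum_smul_mem_stdSimplex (fun j => hl _) hs)
        (v := v) (fun k => ?_) h.1.le_transpose_mulVec
      rw [Matrix.mulVec_smul, Pi.smul_apply, smul_eq_mul, inv_mul_le_iff₀ hs, mul_comm]
      exact hle k
    rw [← (h.2 _ _ hN).2, Matrix.mulVec_smul, Pi.smul_apply, smul_eq_mul, inv_mul_lt_iff₀ hs,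
      mul_comm]
    exact hlt
  · push Not at hc
    obtain ⟨u, hu, hui⟩ := hc
    rw [LinearMap.proj_apply] at hui
    have hu0 : ∀ k, 0 ≤ u k := fun k => by simpa [a] using hu (Sum.inr k) (Finset.mem_univ _)
    have huA : ∀ j, v * ∑ k, u k ≤ (Aᵀ *ᵥ u) j := fun j => by
      simpa [a, Matrix.mulVec_transpose] using hu (Sum.inl j) (Finset.mem_univ _)
    have hs : 0 < ∑ k, u k :=
      hui.trans_le (Finset.single_le_sum (fun k _ => hu0 k) (Finset.mem_univ i))
    have hN : IsNashEquilibrium A ((∑ k, u k)⁻¹ • u) y := by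
      refine isNashEquilibrium_of_bounds (inv_sum_smul_mem_stdSimplex hu0 hs) h.1.2.1
        (v := v) h.1.mulVec_le (fun j => ?_)
      rw [Matrix.mulVec_smul, Pi.smul_apply, smul_eq_mul, le_inv_mul_iff₀ hs, mul_comm]
      exact huA j
    have := congrFun (h.2 _ _ hN).1 i
    rw [hi, Pi.smul_apply, smul_eq_mul] at this
    exact absurd this (mul_pos (inv_pos.2 hs) hui).ne'

/-- At a unique equilibrium, the opponent's strategy is determined among all mixed strategies by
equalizing the payoffs on the support: a strategy that does so can be mixed into the equilibrium
strategy with a small weight, strict complementarity absorbing the effect off the support. -/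
theorem IsUniqueNashEquilibrium.eq_of_equalizes (h : IsUniqueNashEquilibrium A f y)
    {w : Fin m → ℝ} (hw : w ∈ stdSimplex ℝ (Fin m))
    (hval : ∀ i, f i ≠ 0 → (A *ᵥ w) i = f ⬝ᵥ A *ᵥ y) : w = y := by
  set v := f ⬝ᵥ A *ᵥ y with hv
  have hev : ∀ᶠ ε : ℝ in 𝓝[>] 0, ∀ i, (1 - ε) * (A *ᵥ y) i + ε * (A *ᵥ w) i ≤ v := by
    refine eventually_all.2 fun i => ?_
    by_cases hi : f i = 0
    · have hlt : (1 - (0 : ℝ)) * (A *ᵥ y) i + 0 * (A *ᵥ w) i < v := by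
        simpa using h.mulVec_lt hi
      have hcont : Continuous fun ε : ℝ => (1 - ε) * (A *ᵥ y) i + ε * (A *ᵥ w) i := by fun_prop
      exact ((hcont.tendsto 0).eventually_lt_const hlt).filter_mono nhdsWithin_le_nhds
        |>.mono fun _ => le_of_lt
    · refine Eventually.of_forall fun ε => ?_
      rw [hval i hi, eq_of_dotProduct_eq_of_le h.1.1 h.1.mulVec_le rfl hi]
      exact le_of_eq (by ring)
  obtain ⟨ε, hε, hε0, hε1⟩ := (hev.and (Ioc_mem_nhdsGT (zero_lt_one' ℝ))).exists
  have hN : IsNashEquilibrium A f ((1 - ε) • y + ε • w) := by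
    refine isNashEquilibrium_of_bounds h.1.1
      (convex_stdSimplex ℝ _ h.1.2.1 hw (by linarith) hε0.le (by ring)) (v := v)
      (fun i => ?_) h.1.le_transpose_mulVec
    rw [Matrix.mulVec_add, Matrix.mulVec_smul, Matrix.mulVec_smul]
    exact hε i
  funext j
  have := congrFun (h.2 _ _ hN).2 j
  simp only [Pi.add_apply, Pi.smul_apply, smul_eq_mul] at this
  have h0 : ε * (w j - y j) = 0 := by linarith
  rcases mul_eq_zero.1 h0 with h0 | h0 <;> linarith

end Game

/-! ### Exponential tilting of a probability vector -/

/-- Variance of `a` under the weights `p`. -/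
noncomputable def weightedVar {ι : Type*} [Fintype ι] (p a : ι → ℝ) : ℝ :=
  ∑ i, p i * (a i - p ⬝ᵥ a) ^ 2

/-- The cumulant generating function `log ∑ p i * exp (g i)`. -/
noncomputable def logMGF {ι : Type*} [Fintype ι] (p g : ι → ℝ) : ℝ :=
  Real.log (∑ i, p i * Real.exp (g i))

section Tilt

variable {k : ℕ} {p : Fin k → ℝ}

theorem nonempty_of_mem_stdSimplex {ι : Type*} [Fintype ι] {p : ι → ℝ}
    (hp : p ∈ stdSimplex ℝ ι) : Nonempty ι := by
  by_contra h
  rw [not_nonempty_iff] at h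
  simpa using hp.2

theorem sum_mul_exp_pos (hp : p ∈ stdSimplex ℝ (Fin k)) (hpos : ∀ i, 0 < p i)
    (g : Fin k → ℝ) : 0 < ∑ i, p i * Real.exp (g i) := by
  have := nonempty_of_mem_stdSimplex hp
  exact Finset.sum_pos (fun i _ => mul_pos (hpos i) (Real.exp_pos _)) Finset.univ_nonempty

theorem multWeights_pos (hp : p ∈ stdSimplex ℝ (Fin k)) (hpos : ∀ i, 0 < p i)
    (g : Fin k → ℝ) (i : Fin k) : 0 < multWeights p g i :=
  div_pos (mul_pos (hpos i) (Real.exp_pos _)) (sum_mul_exp_pos hp hpos g)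

theorem multWeights_mem (hp : p ∈ stdSimplex ℝ (Fin k)) (hpos : ∀ i, 0 < p i)
    (g : Fin k → ℝ) : multWeights p g ∈ stdSimplex ℝ (Fin k) := by
  refine ⟨fun i => (multWeights_pos hp hpos g i).le, ?_⟩
  simp only [multWeights, ← Finset.sum_div]
  exact div_self (sum_mul_exp_pos hp hpos g).ne'

theorem sum_multWeights_mul_exp (p g h : Fin k → ℝ) :
    ∑ i, multWeights p g i * Real.exp (h i)
      = (∑ i, p i * Real.exp ((g + h) i)) / ∑ i, p i * Real.exp (g i) := by
  rw [Finset.sum_div]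
  refine Finset.sum_congr rfl fun i _ => ?_
  rw [multWeights, Pi.add_apply, Real.exp_add]
  ring

theorem multWeights_multWeights (hp : p ∈ stdSimplex ℝ (Fin k)) (hpos : ∀ i, 0 < p i)
    (g h : Fin k → ℝ) : multWeights (multWeights p g) h = multWeights p (g + h) := by
  funext i
  have h1 := (sum_mul_exp_pos hp hpos g).ne'
  have h2 := (sum_mul_exp_pos hp hpos (g + h)).ne'
  rw [multWeights, sum_multWeights_mul_exp, multWeights, multWeights, Pi.add_apply, Real.exp_add]
  field_simp

theorem multWeights_add_const (p g : Fin k → ℝ) (c : ℝ) :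
    multWeights p (fun i => g i + c) = multWeights p g := by
  funext i
  simp only [multWeights, Real.exp_add, ← mul_assoc, ← Finset.sum_mul]
  rw [mul_div_mul_right _ _ (Real.exp_pos c).ne']

theorem log_multWeights (hp : p ∈ stdSimplex ℝ (Fin k)) (hpos : ∀ i, 0 < p i)
    (g : Fin k → ℝ) (i : Fin k) :
    Real.log (multWeights p g i) = Real.log (p i) + g i - logMGF p g := by
  rw [multWeights, Real.log_div (mul_pos (hpos i) (Real.exp_pos _)).ne'
    (sum_mul_exp_pos hp hpos g).ne', Real.log_mul (hpos i).ne' (Real.exp_pos _).ne', Real.log_exp,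
    logMGF]

theorem logMGF_multWeights (hp : p ∈ stdSimplex ℝ (Fin k)) (hpos : ∀ i, 0 < p i)
    (g h : Fin k → ℝ) : logMGF (multWeights p g) h = logMGF p (g + h) - logMGF p g := by
  rw [logMGF, sum_multWeights_mul_exp, Real.log_div (sum_mul_exp_pos hp hpos _).ne'
    (sum_mul_exp_pos hp hpos _).ne']
  rfl

/-- Jensen's inequality for the exponential. -/
theorem dotProduct_le_logMGF (hp : p ∈ stdSimplex ℝ (Fin k)) (hpos : ∀ i, 0 < p i)
    (g : Fin k → ℝ) : p ⬝ᵥ g ≤ logMGF p g := by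
  rw [logMGF, Real.le_log_iff_exp_le (sum_mul_exp_pos hp hpos g)]
  simpa [dotProduct] using
    convexOn_exp.map_sum_le (t := Finset.univ) (w := p) (p := g) (fun i _ => hp.1 i) hp.2 (by simp)

/-- The cumulant generating function is convex: its increment from `g` to `g + h` is at most the
slope at `g + h`. -/
theorem logMGF_add_sub_le (hp : p ∈ stdSimplex ℝ (Fin k)) (hpos : ∀ i, 0 < p i)
    (g h : Fin k → ℝ) :
    logMGF p (g + h) - logMGF p g ≤ multWeights p (g + h) ⬝ᵥ h := by
  have := dotProduct_le_logMGF (multWeights_mem hp hpos (g + h)) (multWeights_pos hp hpos (g + h))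
    (-h)
  rw [logMGF_multWeights hp hpos, add_neg_cancel_right, dotProduct_neg] at this
  linarith

theorem weightedVar_nonneg (hp : p ∈ stdSimplex ℝ (Fin k)) (a : Fin k → ℝ) :
    0 ≤ weightedVar p a :=
  Finset.sum_nonneg fun i _ => mul_nonneg (hp.1 i) (sq_nonneg _)

theorem sum_mul_centered (hp : p ∈ stdSimplex ℝ (Fin k)) (a : Fin k → ℝ) :
    ∑ i, p i * (a i - p ⬝ᵥ a) = 0 := by
  simp only [mul_sub, Finset.sum_sub_distrib, ← Finset.sum_mul, hp.2, one_mul]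
  exact sub_self _

theorem abs_dotProduct_le (hp : p ∈ stdSimplex ℝ (Fin k)) {a : Fin k → ℝ} {M : ℝ}
    (ha : ∀ i, |a i| ≤ M) : |p ⬝ᵥ a| ≤ M :=
  abs_le.2 ⟨le_dotProduct_of_mem_stdSimplex hp fun i => (abs_le.1 (ha i)).1,
    dotProduct_le_of_mem_stdSimplex hp fun i => (abs_le.1 (ha i)).2⟩

theorem abs_centered_le (hp : p ∈ stdSimplex ℝ (Fin k)) {a : Fin k → ℝ} {M : ℝ}
    (ha : ∀ i, |a i| ≤ M) (i : Fin k) : |a i - p ⬝ᵥ a| ≤ 2 * M :=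
  (abs_sub _ _).trans (by linarith [ha i, abs_dotProduct_le hp ha])

theorem weightedVar_le_sq (hp : p ∈ stdSimplex ℝ (Fin k)) {a : Fin k → ℝ} {s : ℝ}
    (ha : ∀ i, |a i| ≤ s) : weightedVar p a ≤ s ^ 2 := by
  have h1 : weightedVar p a = p ⬝ᵥ (fun i => a i ^ 2) - (p ⬝ᵥ a) ^ 2 := by
    have h0 := sum_mul_centered hp a
    have : weightedVar p a = ∑ i, (p i * a i ^ 2 - (p i * a i) * (p ⬝ᵥ a)
        - (p ⬝ᵥ a) * (p i * (a i - p ⬝ᵥ a))) :=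
      Finset.sum_congr rfl fun i _ => by ring
    rw [this, Finset.sum_sub_distrib, Finset.sum_sub_distrib, ← Finset.mul_sum, h0,
      ← Finset.sum_mul]
    simp only [dotProduct]
    ring
  have h2 : p ⬝ᵥ (fun i => a i ^ 2) ≤ s ^ 2 :=
    dotProduct_le_of_mem_stdSimplex hp fun i => sq_le_sq' (by linarith [(abs_le.1 (ha i)).1])
      (abs_le.1 (ha i)).2
  nlinarith [sq_nonneg (p ⬝ᵥ a)]

theorem weightedVar_smul_add_smul_le (hp : p ∈ stdSimplex ℝ (Fin k)) (r s : ℝ)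
    (a e : Fin k → ℝ) :
    weightedVar p (r • a + s • e) ≤ 2 * r ^ 2 * weightedVar p a + 2 * s ^ 2 * weightedVar p e := by
  simp only [weightedVar, Finset.mul_sum, ← Finset.sum_add_distrib]
  refine Finset.sum_le_sum fun i _ => ?_
  rw [dotProduct_add, dotProduct_smul, dotProduct_smul]
  simp only [Pi.add_apply, Pi.smul_apply, smul_eq_mul]
  nlinarith [mul_nonneg (hp.1 i)
    (sq_nonneg (r * (a i - p ⬝ᵥ a) - s * (e i - p ⬝ᵥ e)))]

/-- For a small centered exponent, the normalization of a tilt lies in `[1, 2]`. -/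
theorem sum_mul_exp_mem_Icc (hp : p ∈ stdSimplex ℝ (Fin k)) {d : Fin k → ℝ}
    (hd0 : ∑ i, p i * d i = 0) (hd : ∀ i, |d i| ≤ 1) :
    ∑ i, p i * Real.exp (d i) ∈ Set.Icc (1 : ℝ) 2 := by
  constructor
  · calc (1 : ℝ) = ∑ i, p i * (d i + 1) := by
          simp only [mul_add, Finset.sum_add_distrib, hd0, mul_one, hp.2, zero_add]
      _ ≤ _ := Finset.sum_le_sum fun i _ =>
          mul_le_mul_of_nonneg_left (Real.add_one_le_exp _) (hp.1 i)
  · calc _ ≤ ∑ i, p i * (1 + d i + 1) := Finset.sum_le_sum fun i _ =>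
          mul_le_mul_of_nonneg_left (by
            have h1 := (abs_le.1 (Real.abs_exp_sub_one_sub_id_le (hd i))).2
            have h2 : d i ^ 2 ≤ 1 := (sq_le_one_iff_abs_le_one _).2 (hd i)
            linarith) (hp.1 i)
      _ = 2 := by
          simp only [mul_add, Finset.sum_add_distrib, hd0, mul_one, hp.2]
          norm_num

/-- Tilting by a small exponent moves a probability vector, in the `ℓ¹` norm, by a multiple of the
standard deviation of the exponent. -/
theorem sq_sum_abs_multWeights_sub_le (hp : p ∈ stdSimplex ℝ (Fin k)) {d : Fin k → ℝ}
    (hd : ∀ i, |d i - p ⬝ᵥ d| ≤ 1) :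
    (∑ i, |multWeights p d i - p i|) ^ 2 ≤ 16 * weightedVar p d := by
  set c : Fin k → ℝ := fun i => d i - p ⬝ᵥ d with hc
  have hq : multWeights p d = multWeights p c := (multWeights_add_const p d (-(p ⬝ᵥ d))).symm
  have hc0 : ∑ i, p i * c i = 0 := sum_mul_centered hp d
  obtain ⟨hZ1, -⟩ := sum_mul_exp_mem_Icc hp hc0 hd
  set Z := ∑ i, p i * Real.exp (c i) with hZ
  have hexp : ∀ i, |Real.exp (c i) - 1| ≤ 2 * |c i| := fun i => Real.abs_exp_sub_one_le (hd i)
  have hS : ∑ i, p i * |Real.exp (c i) - 1| ≤ 2 * ∑ i, p i * |c i| := by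
    rw [Finset.mul_sum]
    refine Finset.sum_le_sum fun i _ => ?_
    nlinarith [hexp i, hp.1 i]
  have hZS : Z - 1 ≤ ∑ i, p i * |Real.exp (c i) - 1| := by
    calc Z - 1 = ∑ i, p i * (Real.exp (c i) - 1) := by
          simp only [mul_sub, Finset.sum_sub_distrib, mul_one, hp.2, hZ]
      _ ≤ _ := Finset.sum_le_sum fun i _ => mul_le_mul_of_nonneg_left (le_abs_self _) (hp.1 i)
  have hpt : ∀ i, |multWeights p d i - p i| ≤ p i * |Real.exp (c i) - 1| + p i * (Z - 1) := by
    intro i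
    have e1 : multWeights p d i - p i = (p i * (Real.exp (c i) - 1) - p i * (Z - 1)) / Z := by
      rw [hq, multWeights, ← hZ]
      field_simp
      ring
    rw [e1, abs_div, abs_of_pos (by linarith : 0 < Z)]
    refine (div_le_self (abs_nonneg _) hZ1).trans ((abs_sub _ _).trans ?_)
    rw [abs_mul, abs_of_nonneg (hp.1 i), abs_mul, abs_of_nonneg (hp.1 i),
      abs_of_nonneg (by linarith : 0 ≤ Z - 1)]
  have hsum : ∑ i, |multWeights p d i - p i| ≤ 4 * ∑ i, p i * |c i| := by
    calc _ ≤ ∑ i, (p i * |Real.exp (c i) - 1| + p i * (Z - 1)) :=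
          Finset.sum_le_sum fun i _ => hpt i
      _ = ∑ i, p i * |Real.exp (c i) - 1| + (Z - 1) := by
          rw [Finset.sum_add_distrib, ← Finset.sum_mul, hp.2, one_mul]
      _ ≤ _ := by linarith
  have hcs : (∑ i, p i * |c i|) ^ 2 ≤ weightedVar p d := by
    have := (convexOn_pow 2).map_sum_le (t := Finset.univ) (w := p) (p := fun i => |c i|)
      (fun i _ => hp.1 i) hp.2 (fun i _ => Set.mem_Ici.2 (abs_nonneg (c i)))
    simpa [weightedVar, hc] using this
  calc _ ≤ (4 * ∑ i, p i * |c i|) ^ 2 := by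
        gcongr
    _ = 16 * (∑ i, p i * |c i|) ^ 2 := by ring
    _ ≤ _ := by linarith

/-- Effect of a tilt by `τ a - γ a'` on the mean of `a`: since this exponent is
`-(γ - τ) a + γ (a - a')`, the mean drops by about `(γ - τ)` times the variance of `a`, up to an
error governed by the variance of `a - a'`. -/
theorem multWeights_dotProduct_le (hp : p ∈ stdSimplex ℝ (Fin k)) {a a' : Fin k → ℝ} {M γ τ : ℝ}
    (ha : ∀ i, |a i| ≤ M) (ha' : ∀ i, |a' i| ≤ M) (hτ : 0 ≤ τ) (hτγ : τ ≤ γ)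
    (hγ : 128 * M * γ ≤ 1) :
    multWeights p (τ • a - γ • a') ⬝ᵥ a ≤ p ⬝ᵥ a - (γ - τ) / 2 * weightedVar p a
      + γ / 16 * weightedVar p a + 9 * γ * weightedVar p (a - a') := by
  have hγ0 : 0 ≤ γ := hτ.trans hτγ
  set x : Fin k → ℝ := fun i => a i - p ⬝ᵥ a with hx
  set e : Fin k → ℝ := fun i => (a - a') i - p ⬝ᵥ (a - a') with he
  set d : Fin k → ℝ := fun i => -(γ - τ) * x i + γ * e i with hd
  have hx0 : ∑ i, p i * x i = 0 := sum_mul_centered hp a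
  have he0 : ∑ i, p i * e i = 0 := sum_mul_centered hp (a - a')
  have hd0 : ∑ i, p i * d i = 0 := by
    have : ∀ i, p i * d i = -(γ - τ) * (p i * x i) + γ * (p i * e i) := fun i => by
      simp only [hd]; ring
    simp only [this, Finset.sum_add_distrib, ← Finset.mul_sum, hx0, he0]
    ring
  have hxM : ∀ i, |x i| ≤ 2 * M := abs_centered_le hp ha
  have heM : ∀ i, |e i| ≤ 2 * (2 * M) := abs_centered_le hp fun i => by
    rw [Pi.sub_apply]
    exact (abs_sub _ _).trans (by linarith [ha i, ha' i])
  have hd1 : ∀ i, |d i| ≤ 1 := fun i => by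
    have h1 : |d i| ≤ (γ - τ) * |x i| + γ * |e i| := by
      refine (abs_add_le _ _).trans (le_of_eq ?_)
      rw [abs_mul, abs_mul, abs_neg, abs_of_nonneg (sub_nonneg.2 hτγ), abs_of_nonneg hγ0]
    have h2 : (γ - τ) * |x i| ≤ γ * (2 * M) :=
      mul_le_mul (by linarith) (hxM i) (abs_nonneg _) hγ0
    have h3 : γ * |e i| ≤ γ * (2 * (2 * M)) := mul_le_mul_of_nonneg_left (heM i) hγ0
    have h4 : 0 ≤ γ * (2 * M) := (mul_nonneg hγ0 (abs_nonneg _)).trans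
      (mul_le_mul_of_nonneg_left (hxM i) hγ0)
    nlinarith
  have hq : multWeights p (τ • a - γ • a') = multWeights p d := by
    rw [← multWeights_add_const p d (τ * (p ⬝ᵥ a) - γ * (p ⬝ᵥ a'))]
    congr 1
    funext i
    simp only [hd, hx, he, dotProduct_sub, Pi.sub_apply, Pi.smul_apply, smul_eq_mul]
    ring
  obtain ⟨hZ1, hZ2⟩ := sum_mul_exp_mem_Icc hp hd0 hd1
  set Z := ∑ i, p i * Real.exp (d i) with hZ
  have hmean : multWeights p d ⬝ᵥ a = p ⬝ᵥ a + (∑ i, p i * (Real.exp (d i) * x i)) / Z := by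
    have h1 : ∑ i, p i * (Real.exp (d i) * x i)
        = ∑ i, p i * Real.exp (d i) * a i - Z * (p ⬝ᵥ a) := by
      rw [hZ, Finset.sum_mul, ← Finset.sum_sub_distrib]
      exact Finset.sum_congr rfl fun i _ => by simp only [hx]; ring
    have h2 : multWeights p d ⬝ᵥ a = (∑ i, p i * Real.exp (d i) * a i) / Z := by
      rw [dotProduct, Finset.sum_div]
      refine Finset.sum_congr rfl fun i _ => ?_
      rw [multWeights, ← hZ]
      ring
    rw [h1, h2]
    field_simp
    ring
  -- Second-order expansion of `exp (d i)`. The cross term, split as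
  -- `e * x ≤ x ^ 2 / 32 + 8 * e ^ 2`, and the remainder cost only `γ / 16` times the variance of
  -- `a`, less than the gain at `τ = η / 2`.
  have hpt : ∀ i, p i * (Real.exp (d i) * x i) ≤ p i * x i
      + (-(γ - τ) * (p i * x i ^ 2) + γ / 16 * (p i * x i ^ 2) + 9 * γ * (p i * e i ^ 2)) := by
    intro i
    have hr := Real.abs_exp_sub_one_sub_id_le (hd1 i)
    have h1 : Real.exp (d i) * x i ≤ (1 + d i) * x i + d i ^ 2 * (2 * M) := by
      have h2 : (Real.exp (d i) - 1 - d i) * x i ≤ d i ^ 2 * (2 * M) :=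
        (le_abs_self _).trans ((abs_mul _ _).le.trans
          (mul_le_mul hr (hxM i) (abs_nonneg _) (sq_nonneg _)))
      linarith
    have h3 : d i ^ 2 ≤ 2 * γ ^ 2 * (x i ^ 2 + e i ^ 2) := by
      have h4 : d i ^ 2 ≤ 2 * ((γ - τ) ^ 2 * x i ^ 2) + 2 * (γ ^ 2 * e i ^ 2) := by
        simp only [hd]
        nlinarith [sq_nonneg ((γ - τ) * x i + γ * e i)]
      have h5 : (γ - τ) ^ 2 ≤ γ ^ 2 := pow_le_pow_left₀ (sub_nonneg.2 hτγ) (by linarith) 2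
      nlinarith [mul_le_mul_of_nonneg_right h5 (sq_nonneg (x i))]
    have hM0 : 0 ≤ 2 * M := (abs_nonneg _).trans (hxM i)
    have h6 : d i ^ 2 * (2 * M) ≤ γ / 32 * (x i ^ 2 + e i ^ 2) := by
      refine (mul_le_mul_of_nonneg_right h3 hM0).trans ?_
      have h7 : 0 ≤ γ * (x i ^ 2 + e i ^ 2) := by positivity
      nlinarith [mul_le_mul_of_nonneg_right hγ h7]
    have h8 : γ * (e i * x i) ≤ γ * (x i ^ 2 / 32 + 8 * e i ^ 2) :=
      mul_le_mul_of_nonneg_left (by nlinarith [sq_nonneg (x i - 16 * e i)]) hγ0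
    have h9 : d i * x i = -(γ - τ) * x i ^ 2 + γ * (e i * x i) := by simp only [hd]; ring
    have h10 : 0 ≤ γ * e i ^ 2 := by positivity
    have h11 : Real.exp (d i) * x i
        ≤ x i + (-(γ - τ) * x i ^ 2 + γ / 16 * x i ^ 2 + 9 * γ * e i ^ 2) := by
      linarith
    calc _ ≤ _ := mul_le_mul_of_nonneg_left h11 (hp.1 i)
      _ = _ := by ring
  have hN : ∑ i, p i * (Real.exp (d i) * x i) ≤ -(γ - τ) * weightedVar p a
      + (γ / 16 * weightedVar p a + 9 * γ * weightedVar p (a - a')) := by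
    refine (Finset.sum_le_sum fun i _ => hpt i).trans (le_of_eq ?_)
    have hVx : weightedVar p a = ∑ i, p i * x i ^ 2 := rfl
    have hEe : weightedVar p (a - a') = ∑ i, p i * e i ^ 2 := rfl
    rw [hVx, hEe]
    simp only [Finset.sum_add_distrib, ← Finset.mul_sum, hx0]
    ring
  have hV := weightedVar_nonneg hp a
  have hE := weightedVar_nonneg hp (a - a')
  set V := weightedVar p a
  set E := weightedVar p (a - a')
  -- Dividing by `Z ∈ [1, 2]` at most halves the negative part and does not increase the
  -- positive one.
  have hdiv : (∑ i, p i * (Real.exp (d i) * x i)) / Z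
      ≤ -((γ - τ) / 2 * V) + (γ / 16 * V + 9 * γ * E) := by
    rw [div_le_iff₀ (by linarith)]
    have hU : 0 ≤ (γ - τ) * V := mul_nonneg (sub_nonneg.2 hτγ) hV
    have hW : 0 ≤ γ / 16 * V + 9 * γ * E := by positivity
    nlinarith [mul_le_mul_of_nonneg_left hZ1 hW, mul_le_mul_of_nonneg_left hZ2 hU]
  rw [hq, hmean]
  linarith

/-- The second-order decrease behind the convergence. Convexity is used on `[0, η / 2]` and on
`[η / 2, η]` separately; on the first interval the slope is already smaller than the mean of `a`
by a multiple of `γ` times the variance, even when `γ = η`. -/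
theorem logMGF_sub_le (hp : p ∈ stdSimplex ℝ (Fin k)) (hpos : ∀ i, 0 < p i)
    {a a' : Fin k → ℝ} {M γ η : ℝ} (ha : ∀ i, |a i| ≤ M) (ha' : ∀ i, |a' i| ≤ M) (hη : 0 ≤ η)
    (hηγ : η ≤ γ) (hγ : 128 * M * γ ≤ 1) :
    logMGF p (η • a - γ • a') - logMGF p (-(γ • a')) ≤ η * (p ⬝ᵥ a)
      - η * γ / 16 * weightedVar p a + 9 * η * γ * weightedVar p (a - a') := by
  have e1 : -(γ • a') + (η / 2) • a = (η / 2) • a - γ • a' := by abel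
  have e2 : (η / 2) • a - γ • a' + (η / 2) • a = η • a - γ • a' := by
    funext i
    simp only [Pi.add_apply, Pi.sub_apply, Pi.smul_apply, smul_eq_mul]
    ring
  have h1 := logMGF_add_sub_le hp hpos (-(γ • a')) ((η / 2) • a)
  have h2 := logMGF_add_sub_le hp hpos ((η / 2) • a - γ • a') ((η / 2) • a)
  rw [e1, dotProduct_smul, smul_eq_mul] at h1
  rw [e2, dotProduct_smul, smul_eq_mul] at h2
  have h3 := multWeights_dotProduct_le hp ha ha' (by linarith : 0 ≤ η / 2)
    (by linarith : η / 2 ≤ γ) hγ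
  have h4 := multWeights_dotProduct_le hp ha ha' hη hηγ hγ
  have hV := weightedVar_nonneg hp a
  set V := weightedVar p a
  set E := weightedVar p (a - a')
  have h5 := mul_le_mul_of_nonneg_left h3 (by linarith : 0 ≤ η / 2)
  have h6 := mul_le_mul_of_nonneg_left h4 (by linarith : 0 ≤ η / 2)
  have h7 : 0 ≤ η * ((γ - η) * V) := mul_nonneg hη (mul_nonneg (sub_nonneg.2 hηγ) hV)
  nlinarith

end Tilt

/-! ### Energy estimates for one player -/

/-- The cross entropy `-∑ s i * log (q i)`. It differs from the Kullback–Leibler divergence of `q`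
from `s` by a constant depending on `s` only. -/
noncomputable def crossEntropy {ι : Type*} [Fintype ι] (s q : ι → ℝ) : ℝ :=
  -∑ i, s i * Real.log (q i)

section Player

variable {k : ℕ} {p s : Fin k → ℝ}

theorem apply_le_one_of_mem_stdSimplex {ι : Type*} [Fintype ι] {p : ι → ℝ}
    (hp : p ∈ stdSimplex ℝ ι) (i : ι) : p i ≤ 1 :=
  hp.2 ▸ Finset.single_le_sum (fun j _ => hp.1 j) (Finset.mem_univ i)

theorem neg_mul_log_nonneg (hs : s ∈ stdSimplex ℝ (Fin k)) (hp : p ∈ stdSimplex ℝ (Fin k))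
    (i : Fin k) : 0 ≤ -(s i * Real.log (p i)) :=
  neg_nonneg.2 (mul_nonpos_of_nonneg_of_nonpos (hs.1 i)
    (Real.log_nonpos (hp.1 i) (apply_le_one_of_mem_stdSimplex hp i)))

theorem crossEntropy_nonneg (hs : s ∈ stdSimplex ℝ (Fin k)) (hp : p ∈ stdSimplex ℝ (Fin k)) :
    0 ≤ crossEntropy s p := by
  rw [crossEntropy, ← Finset.sum_neg_distrib]
  exact Finset.sum_nonneg fun i _ => neg_mul_log_nonneg hs hp i

theorem crossEntropy_multWeights (hs : s ∈ stdSimplex ℝ (Fin k)) (hp : p ∈ stdSimplex ℝ (Fin k))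
    (hpos : ∀ i, 0 < p i) (g : Fin k → ℝ) :
    crossEntropy s (multWeights p g) = crossEntropy s p - s ⬝ᵥ g + logMGF p g := by
  simp only [crossEntropy, log_multWeights hp hpos, mul_sub, mul_add, Finset.sum_sub_distrib,
    Finset.sum_add_distrib, ← Finset.sum_mul, hs.2, one_mul, dotProduct]
  ring

/-- One round of the update, seen on the auxiliary strategy `multWeights p (-(γ • a'))`, which
moves by the current payoff vector `a` alone, with step `η`. -/
theorem crossEntropy_step_le (hs : s ∈ stdSimplex ℝ (Fin k)) (hp : p ∈ stdSimplex ℝ (Fin k))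
    (hpos : ∀ i, 0 < p i) {a a' : Fin k → ℝ} {M γ η : ℝ} (ha : ∀ i, |a i| ≤ M)
    (ha' : ∀ i, |a' i| ≤ M) (hη : 0 ≤ η) (hηγ : η ≤ γ) (hγ : 128 * M * γ ≤ 1) :
    crossEntropy s (multWeights (multWeights p ((η + γ) • a - γ • a')) (-(γ • a)))
      ≤ crossEntropy s (multWeights p (-(γ • a'))) - η * (s ⬝ᵥ a) + η * (p ⬝ᵥ a)
        - η * γ / 16 * weightedVar p a + 9 * η * γ * weightedVar p (a - a') := by
  have e1 : (η + γ) • a - γ • a' + -(γ • a) = -(γ • a') + η • a := by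
    rw [add_smul]; abel
  have e2 : -(γ • a') + η • a = η • a - γ • a' := by abel
  rw [multWeights_multWeights hp hpos, e1, ← multWeights_multWeights hp hpos,
    crossEntropy_multWeights hs (multWeights_mem hp hpos _) (multWeights_pos hp hpos _),
    logMGF_multWeights hp hpos, dotProduct_smul, smul_eq_mul, e2]
  linarith [logMGF_sub_le hp hpos ha ha' hη hηγ hγ]

theorem sq_sum_abs_step_sub_le (hp : p ∈ stdSimplex ℝ (Fin k))
    {a a' : Fin k → ℝ} {M γ η : ℝ} (ha : ∀ i, |a i| ≤ M) (ha' : ∀ i, |a' i| ≤ M) (hη : 0 ≤ η)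
    (hηγ : η ≤ γ) (hγ : 128 * M * γ ≤ 1) :
    (∑ i, |multWeights p ((η + γ) • a - γ • a') i - p i|) ^ 2
      ≤ 32 * η ^ 2 * weightedVar p a + 32 * γ ^ 2 * weightedVar p (a - a') := by
  have hγ0 : 0 ≤ γ := hη.trans hηγ
  have e1 : (η + γ) • a - γ • a' = η • a + γ • (a - a') := by
    rw [add_smul, smul_sub]; abel
  rw [e1]
  have hd : ∀ i, |(η • a + γ • (a - a')) i| ≤ 3 * (M * γ) := fun i => by
    simp only [Pi.add_apply, Pi.smul_apply, Pi.sub_apply, smul_eq_mul]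
    have h1 : |η * a i| ≤ γ * M := by
      rw [abs_mul, abs_of_nonneg hη]
      exact mul_le_mul hηγ (ha i) (abs_nonneg _) hγ0
    have h2 : |γ * (a i - a' i)| ≤ γ * (M + M) := by
      rw [abs_mul, abs_of_nonneg hγ0]
      exact mul_le_mul_of_nonneg_left ((abs_sub _ _).trans (add_le_add (ha i) (ha' i))) hγ0
    exact (abs_add_le _ _).trans (by linarith)
  refine (sq_sum_abs_multWeights_sub_le hp fun i => (abs_centered_le hp hd i).trans ?_).trans ?_
  · have : 0 ≤ 3 * (M * γ) := (abs_nonneg _).trans (hd i)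
    linarith
  · linarith [weightedVar_smul_add_smul_le hp η γ a (a - a')]

/-- A bound on the cross entropy of the auxiliary strategy keeps the actual strategy away from
zero on the support of `s`. -/
theorem exp_le_of_crossEntropy_le (hs : s ∈ stdSimplex ℝ (Fin k))
    (hp : p ∈ stdSimplex ℝ (Fin k)) (hpos : ∀ i, 0 < p i) {a' : Fin k → ℝ} {M γ C : ℝ}
    (ha' : ∀ i, |a' i| ≤ M) (hγ : 0 ≤ γ) (hC : crossEntropy s (multWeights p (-(γ • a'))) ≤ C)
    {i : Fin k} (hi : s i ≠ 0) : Real.exp (-(C / s i) - 2 * (γ * M)) ≤ p i := by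
  have hsi : 0 < s i := lt_of_le_of_ne (hs.1 i) hi.symm
  set q := multWeights p (-(γ • a')) with hq
  have h1 : -(s i * Real.log (q i)) ≤ C := by
    refine le_trans ?_ hC
    rw [crossEntropy, ← Finset.sum_neg_distrib]
    exact Finset.single_le_sum (f := fun i => -(s i * Real.log (q i)))
      (fun j _ => neg_mul_log_nonneg hs (multWeights_mem hp hpos _) j) (Finset.mem_univ i)
  have h2 : -(C / s i) ≤ Real.log (q i) := by
    rw [neg_le, le_div_iff₀ hsi]
    linarith
  rw [hq, log_multWeights hp hpos, Pi.neg_apply, Pi.smul_apply, smul_eq_mul] at h2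
  have h3 := dotProduct_le_logMGF hp hpos (-(γ • a'))
  rw [dotProduct_neg, dotProduct_smul, smul_eq_mul] at h3
  have h4 := mul_le_mul_of_nonneg_left (abs_le.1 (ha' i)).1 hγ
  have h5 := mul_le_mul_of_nonneg_left (abs_le.1 (abs_dotProduct_le hp ha')).2 hγ
  rw [← Real.le_log_iff_exp_le (hpos i)]
  linarith

theorem eq_dotProduct_of_weightedVar_eq_zero (hp : p ∈ stdSimplex ℝ (Fin k)) {a : Fin k → ℝ}
    (h : weightedVar p a = 0) {i : Fin k} (hi : p i ≠ 0) : a i = p ⬝ᵥ a := by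
  have := (Finset.sum_eq_zero_iff_of_nonneg fun j _ =>
    mul_nonneg (hp.1 j) (sq_nonneg _)).1 h i (Finset.mem_univ i)
  rcases mul_eq_zero.1 this with h | h
  · exact absurd h hi
  · exact sub_eq_zero.1 (pow_eq_zero_iff two_ne_zero |>.1 h)

end Player

/-! ### Convergence of the iterates -/

section Dynamics

variable {n m : ℕ} {A : Matrix (Fin n) (Fin m) ℝ} {M : ℝ}

theorem abs_mulVec_le (hA : ∀ i j, |A i j| ≤ M) {y : Fin m → ℝ} (hy : y ∈ stdSimplex ℝ (Fin m))
    (i : Fin n) : |(A *ᵥ y) i| ≤ M := by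
  rw [Matrix.mulVec, dotProduct_comm]
  exact abs_dotProduct_le hy (hA i)

theorem abs_mulVec_sub_le (hA : ∀ i j, |A i j| ≤ M) (y y' : Fin m → ℝ) (i : Fin n) :
    |(A *ᵥ y - A *ᵥ y') i| ≤ M * ∑ j, |y j - y' j| := by
  rw [← Matrix.mulVec_sub, Matrix.mulVec, dotProduct, Finset.mul_sum]
  refine (Finset.abs_sum_le_sum_abs _ _).trans (Finset.sum_le_sum fun j _ => ?_)
  rw [abs_mul]
  exact mul_le_mul_of_nonneg_right (hA i j) (abs_nonneg _)

theorem weightedVar_mulVec_sub_le (hA : ∀ i j, |A i j| ≤ M) {f : Fin n → ℝ}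
    (hf : f ∈ stdSimplex ℝ (Fin n)) (y y' : Fin m → ℝ) :
    weightedVar f (A *ᵥ y - A *ᵥ y') ≤ M ^ 2 * (∑ j, |y j - y' j|) ^ 2 := by
  rw [← mul_pow]
  exact weightedVar_le_sq hf (abs_mulVec_sub_le hA y y')

theorem amwu_fst_add_two (A : Matrix (Fin n) (Fin m) ℝ) (η α : ℝ) (t : ℕ) :
    (amwu A η α (t + 2)).1 = multWeights (amwu A η α (t + 1)).1
      ((η + η * α) • (A *ᵥ (amwu A η α (t + 1)).2) - (η * α) • (A *ᵥ (amwu A η α t).2)) := by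
  rw [amwu, amwuStep]
  refine congrArg (multWeights _) (funext fun i => ?_)
  simp only [Pi.sub_apply, Pi.smul_apply, smul_eq_mul]
  ring

theorem amwu_snd_add_two (A : Matrix (Fin n) (Fin m) ℝ) (η α : ℝ) (t : ℕ) :
    (amwu A η α (t + 2)).2 = multWeights (amwu A η α (t + 1)).2
      ((η + η * α) • ((-Aᵀ) *ᵥ (amwu A η α (t + 1)).1)
        - (η * α) • ((-Aᵀ) *ᵥ (amwu A η α t).1)) := by
  rw [amwu, amwuStep]
  refine congrArg (multWeights _) (funext fun j => ?_)
  simp only [Pi.sub_apply, Pi.smul_apply, smul_eq_mul, Matrix.neg_mulVec, Pi.neg_apply]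
  ring

theorem uniform_mem_stdSimplex {k : ℕ} (hk : Nonempty (Fin k)) :
    (fun _ => 1 / (k : ℝ)) ∈ stdSimplex ℝ (Fin k) ∧ ∀ _ : Fin k, 0 < 1 / (k : ℝ) := by
  have hk : 0 < (k : ℝ) := Nat.cast_pos.2 (Fin.pos_iff_nonempty.2 hk)
  refine ⟨⟨fun _ => by positivity, ?_⟩, fun _ => by positivity⟩
  simp [hk.ne']

/-- Both players' iterates are mixed strategies with full support. -/
theorem amwu_mem_and_pos (hn : Nonempty (Fin n)) (hm : Nonempty (Fin m)) (η α : ℝ) (t : ℕ) :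
    ((amwu A η α t).1 ∈ stdSimplex ℝ (Fin n) ∧ ∀ i, 0 < (amwu A η α t).1 i) ∧
      ((amwu A η α t).2 ∈ stdSimplex ℝ (Fin m) ∧ ∀ j, 0 < (amwu A η α t).2 j) := by
  induction t using Nat.strong_induction_on with
  | _ t ih =>
    match t with
    | 0 => exact ⟨uniform_mem_stdSimplex hn, uniform_mem_stdSimplex hm⟩
    | 1 => exact ⟨uniform_mem_stdSimplex hn, uniform_mem_stdSimplex hm⟩
    | t + 2 =>
      obtain ⟨⟨h1, h2⟩, h3, h4⟩ := ih (t + 1) (by omega)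
      rw [amwu_fst_add_two, amwu_snd_add_two]
      exact ⟨⟨multWeights_mem h1 h2 _, multWeights_pos h1 h2 _⟩,
        multWeights_mem h3 h4 _, multWeights_pos h3 h4 _⟩

/-- A nonnegative energy that loses at least `u t` in round `t` forces `u` to tend to zero. -/
theorem tendsto_zero_of_energy_decrease {E u : ℕ → ℝ} (hE : ∀ t, 0 ≤ E t) (hu : ∀ t, 0 ≤ u t)
    (h : ∀ t, E (t + 1) ≤ E t - u t) : Tendsto u atTop (𝓝 0) := by
  have hanti : Antitone E := antitone_nat_of_succ_le fun t => by linarith [h t, hu t]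
  obtain ⟨l, hl⟩ : ∃ l, Tendsto E atTop (𝓝 l) :=
    ⟨_, tendsto_atTop_ciInf hanti ⟨0, by rintro _ ⟨t, rfl⟩; exact hE t⟩⟩
  have hdiff : Tendsto (fun t => E t - E (t + 1)) atTop (𝓝 0) := by
    simpa using hl.sub (hl.comp (tendsto_add_atTop_nat 1))
  exact squeeze_zero hu (fun t => by linarith [h t]) hdiff

/-- The energy: cross entropies of both auxiliary strategies relative to the equilibrium, plus a
multiple of the squared `ℓ¹` movement of the last round. `cur` and `prev` are the pairs of
strategies of the current and of the previous round. -/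
noncomputable def amwuEnergy (A : Matrix (Fin n) (Fin m) ℝ) (M η γ : ℝ) (fstar : Fin n → ℝ)
    (ystar : Fin m → ℝ) (cur prev : (Fin n → ℝ) × (Fin m → ℝ)) : ℝ :=
  crossEntropy fstar (multWeights cur.1 (-(γ • (A *ᵥ prev.2)))) +
    crossEntropy ystar (multWeights cur.2 (-(γ • ((-Aᵀ) *ᵥ prev.1)))) +
    18 * M ^ 2 * (η * γ) *
      ((∑ i, |cur.1 i - prev.1 i|) ^ 2 + (∑ j, |cur.2 j - prev.2 j|) ^ 2)

/-- The sum over the players of the variance of the payoff vector under the own strategy. -/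
noncomputable def payoffVar (A : Matrix (Fin n) (Fin m) ℝ) (z : (Fin n → ℝ) × (Fin m → ℝ)) : ℝ :=
  weightedVar z.1 (A *ᵥ z.2) + weightedVar z.2 ((-Aᵀ) *ᵥ z.1)

/-- The energy decreases in each round by a multiple of the payoff variance. The terms linear in
`η` cancel between the players up to the equilibrium gap, which has a sign, and the movement term
absorbs the error made by predicting the current payoff by the previous one. -/
theorem amwuEnergy_succ_le {fstar : Fin n → ℝ} {ystar : Fin m → ℝ}
    (hN : IsNashEquilibrium A fstar ystar) (hA : ∀ i j, |A i j| ≤ M) {η α : ℝ} (hη : 0 ≤ η)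
    (hηγ : η ≤ η * α) (hγ : 128 * M * (η * α) ≤ 1) (t : ℕ) :
    amwuEnergy A M η (η * α) fstar ystar (amwu A η α (t + 2)) (amwu A η α (t + 1))
      ≤ amwuEnergy A M η (η * α) fstar ystar (amwu A η α (t + 1)) (amwu A η α t)
        - η * (η * α) / 64 * payoffVar A (amwu A η α (t + 1)) := by
  have hn := nonempty_of_mem_stdSimplex hN.1
  have hm := nonempty_of_mem_stdSimplex hN.2.1
  obtain ⟨⟨hf, hfpos⟩, hy, hypos⟩ := amwu_mem_and_pos (A := A) hn hm η α (t + 1)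
  obtain ⟨⟨hf', -⟩, hy', -⟩ := amwu_mem_and_pos (A := A) hn hm η α t
  have hA' : ∀ j i, |(-Aᵀ) j i| ≤ M := fun j i => by
    rw [Matrix.neg_apply, Matrix.transpose_apply, abs_neg]
    exact hA i j
  have hγ0 : 0 ≤ η * α := hη.trans hηγ
  have hM0 : 0 ≤ M := (abs_nonneg _).trans (hA hn.some hm.some)
  rw [amwuEnergy, amwuEnergy, amwu_fst_add_two, amwu_snd_add_two, payoffVar]
  set γ := η * α
  set f := (amwu A η α (t + 1)).1
  set y := (amwu A η α (t + 1)).2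
  set f' := (amwu A η α t).1
  set y' := (amwu A η α t).2
  have hf1 := crossEntropy_step_le hN.1 hf hfpos (abs_mulVec_le hA hy) (abs_mulVec_le hA hy')
    hη hηγ hγ
  have hy1 := crossEntropy_step_le hN.2.1 hy hypos (abs_mulVec_le hA' hf)
    (abs_mulVec_le hA' hf') hη hηγ hγ
  have hf2 := sq_sum_abs_step_sub_le hf (abs_mulVec_le hA hy) (abs_mulVec_le hA hy') hη hηγ hγ
  have hy2 := sq_sum_abs_step_sub_le hy (abs_mulVec_le hA' hf) (abs_mulVec_le hA' hf') hη hηγ hγ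
  have hf3 := weightedVar_mulVec_sub_le hA hf y y'
  have hy3 := weightedVar_mulVec_sub_le hA' hy f f'
  have hVf := weightedVar_nonneg hf (A *ᵥ y)
  have hVy := weightedVar_nonneg hy ((-Aᵀ) *ᵥ f)
  have hgap : 0 ≤ fstar ⬝ᵥ A *ᵥ y + ystar ⬝ᵥ (-Aᵀ) *ᵥ f := by
    rw [dotProduct_neg_transpose_mulVec]
    linarith [hN.2.2.1 f hf, hN.2.2.2 y hy]
  have hzero : f ⬝ᵥ A *ᵥ y + y ⬝ᵥ (-Aᵀ) *ᵥ f = 0 := by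
    rw [dotProduct_neg_transpose_mulVec]
    ring
  have hηgap := mul_nonneg hη hgap
  generalize hPf : (∑ i, |multWeights f ((η + γ) • A *ᵥ y - γ • A *ᵥ y') i - f i|) ^ 2 = Pf at *
  generalize hPy : (∑ j, |multWeights y ((η + γ) • (-Aᵀ) *ᵥ f - γ • (-Aᵀ) *ᵥ f') j - y j|) ^ 2
    = Py at *
  have hDf : 0 ≤ (∑ i, |f i - f' i|) ^ 2 := sq_nonneg _
  have hDy : 0 ≤ (∑ j, |y j - y' j|) ^ 2 := sq_nonneg _
  generalize (∑ i, |f i - f' i|) ^ 2 = Df at *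
  generalize (∑ j, |y j - y' j|) ^ 2 = Dy at *
  generalize weightedVar f (A *ᵥ y - A *ᵥ y') = Ef at *
  generalize weightedVar y ((-Aᵀ) *ᵥ f - (-Aᵀ) *ᵥ f') = Ey at *
  generalize weightedVar f (A *ᵥ y) = Vf at *
  generalize weightedVar y ((-Aᵀ) *ᵥ f) = Vy at *
  have hc : 0 ≤ η * γ := mul_nonneg hη hγ0
  have hMγ : (M * γ) ^ 2 ≤ (1 / 128) ^ 2 :=
    pow_le_pow_left₀ (mul_nonneg hM0 hγ0) (by linarith) 2
  have hMη : (M * η) ^ 2 ≤ (1 / 128) ^ 2 :=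
    (pow_le_pow_left₀ (mul_nonneg hM0 hη) (mul_le_mul_of_nonneg_left hηγ hM0) 2).trans hMγ
  -- The movement of this round is bounded by the variances and the movement of the previous round.
  have hP : Pf + Py ≤ 32 * η ^ 2 * (Vf + Vy) + 32 * γ ^ 2 * (M ^ 2 * (Df + Dy)) := by
    have : 32 * γ ^ 2 * (Ef + Ey) ≤ 32 * γ ^ 2 * (M ^ 2 * (Df + Dy)) :=
      mul_le_mul_of_nonneg_left (by linarith) (by positivity)
    linarith
  -- With the weight `18 * M ^ 2`, half of the previous movement term suffices here; the other half
  -- pays for the prediction error `hE`.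
  have hmove : 18 * M ^ 2 * (η * γ) * (Pf + Py)
      ≤ η * γ * (3 / 64 * (Vf + Vy)) + 9 * M ^ 2 * (η * γ) * (Df + Dy) := by
    have h1 : (M * η) ^ 2 * (Vf + Vy) ≤ (1 / 128) ^ 2 * (Vf + Vy) :=
      mul_le_mul_of_nonneg_right hMη (by linarith)
    have h2 : (M * γ) ^ 2 * (M ^ 2 * (Df + Dy)) ≤ (1 / 128) ^ 2 * (M ^ 2 * (Df + Dy)) :=
      mul_le_mul_of_nonneg_right hMγ (mul_nonneg (sq_nonneg _) (by linarith))
    have h3 : 0 ≤ M ^ 2 * (Df + Dy) := mul_nonneg (sq_nonneg _) (by linarith)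
    have h4 : 18 * M ^ 2 * (Pf + Py) ≤ 3 / 64 * (Vf + Vy) + 9 * (M ^ 2 * (Df + Dy)) := by
      have := mul_le_mul_of_nonneg_left hP (by positivity : 0 ≤ 18 * M ^ 2)
      nlinarith
    have := mul_le_mul_of_nonneg_left h4 hc
    linarith
  have hE : 9 * η * γ * (Ef + Ey) ≤ 9 * M ^ 2 * (η * γ) * (Df + Dy) := by
    have := mul_le_mul_of_nonneg_left (add_le_add hf3 hy3) (by positivity : 0 ≤ 9 * (η * γ))
    linarith
  have hlin : η * (f ⬝ᵥ A *ᵥ y) + η * (y ⬝ᵥ (-Aᵀ) *ᵥ f) = 0 := by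
    rw [← mul_add, hzero, mul_zero]
  linarith

/-- If both players' payoff vectors are constant on the equilibrium supports, with the values that
the pair `(f, y)` itself yields, then `(f, y)` is the unique equilibrium. -/
theorem IsUniqueNashEquilibrium.eq_of_equalizes_both {fstar f : Fin n → ℝ} {ystar y : Fin m → ℝ}
    (h : IsUniqueNashEquilibrium A fstar ystar) (hf : f ∈ stdSimplex ℝ (Fin n))
    (hy : y ∈ stdSimplex ℝ (Fin m)) (h1 : ∀ i, fstar i ≠ 0 → (A *ᵥ y) i = f ⬝ᵥ A *ᵥ y)
    (h2 : ∀ j, ystar j ≠ 0 → ((-Aᵀ) *ᵥ f) j = y ⬝ᵥ (-Aᵀ) *ᵥ f) : f = fstar ∧ y = ystar := by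
  have e1 := dotProduct_eq_of_eq_on_support h.1.1 h1
  have e2 := dotProduct_eq_of_eq_on_support h.1.2.1 h2
  rw [dotProduct_neg_transpose_mulVec, dotProduct_neg_transpose_mulVec] at e2
  have hv : f ⬝ᵥ A *ᵥ y = fstar ⬝ᵥ A *ᵥ ystar := by
    linarith [h.1.2.2.1 f hf, h.1.2.2.2 y hy]
  refine ⟨h.swap.eq_of_equalizes hf fun j hj => ?_, h.eq_of_equalizes hy fun i hi => ?_⟩
  · rw [h2 j hj, dotProduct_neg_transpose_mulVec, dotProduct_neg_transpose_mulVec, hv]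
  · rw [h1 i hi, hv]

theorem continuous_payoffVar (A : Matrix (Fin n) (Fin m) ℝ) : Continuous (payoffVar A) := by
  unfold payoffVar weightedVar dotProduct Matrix.mulVec dotProduct
  fun_prop

/-- Convergence for explicitly bounded rates: every limit point of the iterates has zero payoff
variance and charges the equilibrium supports, hence is the equilibrium. -/
theorem tendsto_amwu {fstar : Fin n → ℝ} {ystar : Fin m → ℝ}
    (hN : IsUniqueNashEquilibrium A fstar ystar) (hA : ∀ i j, |A i j| ≤ M) {η α : ℝ} (hη : 0 < η)
    (hηγ : η ≤ η * α) (hγ : 128 * M * (η * α) ≤ 1) :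
    Tendsto (fun t => amwu A η α t) atTop (𝓝 (fstar, ystar)) := by
  have hn := nonempty_of_mem_stdSimplex hN.1.1
  have hm := nonempty_of_mem_stdSimplex hN.1.2.1
  have hγ0 : 0 < η * α := hη.trans_le hηγ
  have hmem := amwu_mem_and_pos (A := A) hn hm η α
  have hA' : ∀ j i, |(-Aᵀ) j i| ≤ M := fun j i => by
    rw [Matrix.neg_apply, Matrix.transpose_apply, abs_neg]
    exact hA i j
  set E : ℕ → ℝ := fun t =>
    amwuEnergy A M η (η * α) fstar ystar (amwu A η α (t + 1)) (amwu A η α t) with hE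
  set u : ℕ → ℝ := fun t => η * (η * α) / 64 * payoffVar A (amwu A η α (t + 1)) with hu
  have hc : 0 < η * (η * α) / 64 := by positivity
  have hu0 : ∀ t, 0 ≤ u t := fun t => mul_nonneg hc.le (add_nonneg
    (weightedVar_nonneg (hmem _).1.1 _) (weightedVar_nonneg (hmem _).2.1 _))
  have hstep : ∀ t, E (t + 1) ≤ E t - u t := amwuEnergy_succ_le hN.1 hA hη.le hηγ hγ
  have hCf : ∀ t, 0 ≤ crossEntropy fstar
      (multWeights (amwu A η α (t + 1)).1 (-((η * α) • (A *ᵥ (amwu A η α t).2)))) := fun t =>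
    crossEntropy_nonneg hN.1.1 (multWeights_mem (hmem _).1.1 (hmem _).1.2 _)
  have hCy : ∀ t, 0 ≤ crossEntropy ystar
      (multWeights (amwu A η α (t + 1)).2 (-((η * α) • ((-Aᵀ) *ᵥ (amwu A η α t).1)))) := fun t =>
    crossEntropy_nonneg hN.1.2.1 (multWeights_mem (hmem _).2.1 (hmem _).2.2 _)
  have hD : ∀ t, 0 ≤ 18 * M ^ 2 * (η * (η * α)) *
      ((∑ i, |(amwu A η α (t + 1)).1 i - (amwu A η α t).1 i|) ^ 2 +
        (∑ j, |(amwu A η α (t + 1)).2 j - (amwu A η α t).2 j|) ^ 2) := fun t => by positivity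
  have hE0 : ∀ t, 0 ≤ E t := fun t => add_nonneg (add_nonneg (hCf t) (hCy t)) (hD t)
  have hEle : ∀ t, E t ≤ E 0 := fun t =>
    antitone_nat_of_succ_le (fun t => by linarith [hstep t, hu0 t]) (Nat.zero_le t)
  have hvar : Tendsto (fun t => payoffVar A (amwu A η α (t + 1))) atTop (𝓝 0) := by
    have := (tendsto_zero_of_energy_decrease hE0 hu0 hstep).const_mul (η * (η * α) / 64)⁻¹
    simpa only [hu, inv_mul_cancel_left₀ hc.ne', mul_zero] using this
  have hlowf : ∀ t i, fstar i ≠ 0 →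
      Real.exp (-(E 0 / fstar i) - 2 * (η * α * M)) ≤ (amwu A η α (t + 1)).1 i := fun t i =>
    exp_le_of_crossEntropy_le hN.1.1 (hmem _).1.1 (hmem _).1.2
      (abs_mulVec_le hA (hmem t).2.1) hγ0.le (by
        have := hEle t
        simp only [hE, amwuEnergy] at this ⊢
        linarith [hCy t, hD t])
  have hlowy : ∀ t j, ystar j ≠ 0 →
      Real.exp (-(E 0 / ystar j) - 2 * (η * α * M)) ≤ (amwu A η α (t + 1)).2 j := fun t j =>
    exp_le_of_crossEntropy_le hN.1.2.1 (hmem _).2.1 (hmem _).2.2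
      (abs_mulVec_le hA' (hmem t).1.1) hγ0.le (by
        have := hEle t
        simp only [hE, amwuEnergy] at this ⊢
        linarith [hCf t, hD t])
  rw [← tendsto_add_atTop_iff_nat 1]
  refine tendsto_of_subseq_tendsto fun ns hns => ?_
  obtain ⟨⟨f, y⟩, ⟨hf, hy⟩, φ, hφ, hlim⟩ :=
    ((isCompact_stdSimplex ℝ (Fin n)).prod (isCompact_stdSimplex ℝ (Fin m))).tendsto_subseq
      (x := fun t => amwu A η α (ns t + 1)) fun t => ⟨(hmem _).1.1, (hmem _).2.1⟩
  refine ⟨φ, ?_⟩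
  have hV : payoffVar A (f, y) = 0 := tendsto_nhds_unique
    (((continuous_payoffVar A).tendsto _).comp hlim) (hvar.comp (hns.comp hφ.tendsto_atTop))
  have hVf := weightedVar_nonneg hf (A *ᵥ y)
  have hVy := weightedVar_nonneg hy ((-Aᵀ) *ᵥ f)
  have hV' : weightedVar f (A *ᵥ y) + weightedVar y ((-Aᵀ) *ᵥ f) = 0 := hV
  have hposf : ∀ i, fstar i ≠ 0 → f i ≠ 0 := fun i hi =>
    ((Real.exp_pos _).trans_le (ge_of_tendsto'
      (((continuous_apply i).comp continuous_fst).tendsto _ |>.comp hlim)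
      fun t => hlowf _ i hi)).ne'
  have hposy : ∀ j, ystar j ≠ 0 → y j ≠ 0 := fun j hj =>
    ((Real.exp_pos _).trans_le (ge_of_tendsto'
      (((continuous_apply j).comp continuous_snd).tendsto _ |>.comp hlim)
      fun t => hlowy _ j hj)).ne'
  obtain ⟨rfl, rfl⟩ := hN.eq_of_equalizes_both hf hy
    (fun i hi => eq_dotProduct_of_weightedVar_eq_zero hf (by linarith) (hposf i hi))
    (fun j hj => eq_dotProduct_of_weightedVar_eq_zero hy (by linarith) (hposy j hj))
  exact hlim

end Dynamics

theorem mainTheorem1 {n m : ℕ} (A : Matrix (Fin n) (Fin m) ℝ)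
    (fstar : Fin n → ℝ) (ystar : Fin m → ℝ)
    (hNE : IsUniqueNashEquilibrium A fstar ystar)
    (b : ℝ) (hb : b ∈ Set.Ioc (0 : ℝ) 1) :
    ∃ η₀ : ℝ, 0 < η₀ ∧ ∀ η : ℝ, 0 < η → η < η₀ →
      Tendsto (fun t => amwu A η (η ^ (b - 1)) t) atTop (𝓝 (fstar, ystar)) := by
  obtain ⟨hb0, hb1⟩ := hb
  set M : ℝ := 1 + ∑ i, ∑ j, |A i j| with hM
  have hsum : 0 ≤ ∑ i, ∑ j, |A i j| :=
    Finset.sum_nonneg fun i _ => Finset.sum_nonneg fun j _ => abs_nonneg _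
  have hM0 : 0 < 128 * M := by linarith
  have hA : ∀ i j, |A i j| ≤ M := fun i j => by
    have h1 : |A i j| ≤ ∑ j, |A i j| :=
      Finset.single_le_sum (f := fun j => |A i j|) (fun j _ => abs_nonneg _) (Finset.mem_univ j)
    have h2 : ∑ j, |A i j| ≤ ∑ i, ∑ j, |A i j| :=
      Finset.single_le_sum (f := fun i => ∑ j, |A i j|)
        (fun i _ => Finset.sum_nonneg fun j _ => abs_nonneg _) (Finset.mem_univ i)
    linarith
  -- The summand `1` in `M` keeps it positive when `A = 0`. The threshold makes `η ≤ η ^ b` and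
  -- `128 * M * η ^ b ≤ 1`.
  refine ⟨min 1 ((128 * M)⁻¹ ^ b⁻¹), lt_min one_pos (Real.rpow_pos_of_pos (inv_pos.2 hM0) _),
    fun η hη hη0 => ?_⟩
  have hγ : η * η ^ (b - 1) = η ^ b := by
    rw [Real.rpow_sub_one hη.ne']
    field_simp
  refine tendsto_amwu hNE hA hη ?_ ?_
  · rw [hγ]
    simpa using Real.rpow_le_rpow_of_exponent_ge hη (hη0.le.trans (min_le_left _ _)) hb1
  · rw [hγ]
    have h1 : η ^ b ≤ ((128 * M)⁻¹ ^ b⁻¹) ^ b :=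
      Real.rpow_le_rpow hη.le (hη0.le.trans (min_le_right _ _)) hb0.le
    rw [Real.rpow_inv_rpow (inv_pos.2 hM0).le hb0.ne'] at h1
    calc 128 * M * η ^ b ≤ 128 * M * (128 * M)⁻¹ := mul_le_mul_of_nonneg_left h1 hM0.le
      _ = 1 := mul_inv_cancel₀ hM0.ne'
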